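/- Let $A, X_0 \in \mathbb{R}^{n\times n}$, $B \in \mathbb{R}^{n\times b}$, $C \in \mathbb{R}^{c\times n}$, with $X_0$ symmetric positive semidefinite. Call a real square matrix stable if all its complex eigenvalues have negative real part. Assume that $(A,B)$ is stabilizable (there is a real $K$ with $A-BK$ stable) and $(A,C)$ is detectable (there is a real $L$ with $A-LC$ stable). Consider the differential Riccati equation $$\dot X(t) = \mathcal{R}(X(t)) := A^T X(t) + X(t) A - X(t) B B^T X(t) + C^T C \quad (t \ge 0), \qquad X(0) = X_0 .$$ Then there is exactly one $X_\infty \in \mathbb{R}^{n\times n}$ such that $\mathcal{R}(X_\infty) = 0$ and $\hat A := A - BB^T X_\infty$ is stable, and $X_\infty$ is symmetric positive semidefinite. The Lyapunov equation $$\hat A X_L + X_L \hat A^T + BB^T = 0$$ has exactly one solution $X_L \in \mathbb{R}^{n\times n}$, and $X_L$ is symmetric positive semidefinite. For every $t \ge 0$ the matrix $I_n - (X_L - e^{t\hat A} X_L e^{t\hat A^T})(X_\infty - X_0)$ is invertible, and the differential Riccati equation has exactly one solution on $[0,\infty)$, which is given by $$X(t) = X_\infty - e^{t\hat A^T}(X_\infty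 - X_0)\left(I_n - (X_L - e^{t\hat A} X_L e^{t\hat A^T})(X_\infty - X_0)\right)^{-1} e^{t\hat A}, \qquad t \ge 0 .$$ -/

import Mathlib

open scoped Matrix

noncomputable section

/-- A real square matrix is stable if all its complex eigenvalues have negative real part. -/
def IsStableMatrix {n : ℕ} (A : Matrix (Fin n) (Fin n) ℝ) : Prop :=
  ∀ z ∈ spectrum ℂ (A.map (algebraMap ℝ ℂ)), z.re < 0

/-- `(A, B)` is stabilizable: some state feedback `u = -K x` makes `A - B K` stable. -/
def IsStabilizable {n b : ℕ} (A : Matrix (Fin n) (Fin n) ℝ) (B : Matrix (Fin n) (Fin b) ℝ) :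
    Prop :=
  ∃ K : Matrix (Fin b) (Fin n) ℝ, IsStableMatrix (A - B * K)

/-- `(A, C)` is detectable: some output injection `L` makes `A - L C` stable. -/
def IsDetectable {n c : ℕ} (A : Matrix (Fin n) (Fin n) ℝ) (C : Matrix (Fin c) (Fin n) ℝ) :
    Prop :=
  ∃ L : Matrix (Fin n) (Fin c) ℝ, IsStableMatrix (A - L * C)

/-- The Riccati operator `X ↦ Aᵀ X + X A - X B Bᵀ X + Cᵀ C`. -/
def riccatiOp {n b c : ℕ} (A : Matrix (Fin n) (Fin n) ℝ) (B : Matrix (Fin n) (Fin b) ℝ)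
    (C : Matrix (Fin c) (Fin n) ℝ) (X : Matrix (Fin n) (Fin n) ℝ) : Matrix (Fin n) (Fin n) ℝ :=
  Aᵀ * X + X * A - X * B * Bᵀ * X + Cᵀ * C

/-- The closed-loop matrix `A - B Bᵀ X`. -/
def closedLoop {n b : ℕ} (A : Matrix (Fin n) (Fin n) ℝ) (B : Matrix (Fin n) (Fin b) ℝ)
    (X : Matrix (Fin n) (Fin n) ℝ) : Matrix (Fin n) (Fin n) ℝ :=
  A - B * Bᵀ * X

/-- `X` is a stabilizing solution of the algebraic Riccati equation. -/
def IsStabilizingARESolution {n b c : ℕ} (A : Matrix (Fin n) (Fin n) ℝ)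
    (B : Matrix (Fin n) (Fin b) ℝ) (C : Matrix (Fin c) (Fin n) ℝ)
    (X : Matrix (Fin n) (Fin n) ℝ) : Prop :=
  riccatiOp A B C X = 0 ∧ IsStableMatrix (closedLoop A B X)

/-- `Y` solves the Lyapunov equation `F Y + Y Fᵀ + B Bᵀ = 0`. -/
def IsLyapunovSolution {n b : ℕ} (F : Matrix (Fin n) (Fin n) ℝ) (B : Matrix (Fin n) (Fin b) ℝ)
    (Y : Matrix (Fin n) (Fin n) ℝ) : Prop :=
  F * Y + Y * Fᵀ + B * Bᵀ = 0

/-- `X` solves the differential Riccati equation on `[0, ∞)` with `X 0 = X₀`; the derivative at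
`0` is one-sided, and values of `X` at negative times are irrelevant. -/
def IsDRESolution {n b c : ℕ} (A : Matrix (Fin n) (Fin n) ℝ) (B : Matrix (Fin n) (Fin b) ℝ)
    (C : Matrix (Fin c) (Fin n) ℝ) (X₀ : Matrix (Fin n) (Fin n) ℝ)
    (X : ℝ → Matrix (Fin n) (Fin n) ℝ) : Prop :=
  X 0 = X₀ ∧ ∀ t : ℝ, 0 ≤ t → HasDerivWithinAt X (riccatiOp A B C (X t)) (Set.Ici 0) t

/-- The matrix `I - (Y - e^{tF} Y e^{tFᵀ}) D`, which is inverted in the solution formula. -/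
def formulaCore {n : ℕ} (F Y D : Matrix (Fin n) (Fin n) ℝ) (t : ℝ) :
    Matrix (Fin n) (Fin n) ℝ :=
  1 - (Y - NormedSpace.exp (t • F) * Y * NormedSpace.exp (t • Fᵀ)) * D

/-- The right-hand side of the solution formula,
`Xinf - e^{tFᵀ} (Xinf - X₀) (I - (Y - e^{tF} Y e^{tFᵀ}) (Xinf - X₀))⁻¹ e^{tF}`. -/
def dreFormula {n : ℕ} (F Xinf Y X₀ : Matrix (Fin n) (Fin n) ℝ) (t : ℝ) :
    Matrix (Fin n) (Fin n) ℝ :=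
  Xinf - NormedSpace.exp (t • Fᵀ) * (Xinf - X₀) * (formulaCore F Y (Xinf - X₀) t)⁻¹ *
    NormedSpace.exp (t • F)

end

open Filter Topology

/-! ### Powers of an element of spectral radius less than one -/

/-! Everything algebraic rests on `F * D + D * G = 0` forcing `D = 0` for stable `F`, `G`
(`IsStableMatrix.eq_zero_of_sylvester`): it gives symmetry and uniqueness of the stabilizing
solution and solvability of Lyapunov equations. Their solutions are positive semidefinite by a
Cayley transform argument (`IsStableMatrix.posSemidef_of_lyapunov`). Existence of the stabilizing
solution is policy iteration: the costs of successively improved feedbacks decrease to a positive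
semidefinite solution, which detectability makes stabilizing. The formula is Radon's `V * U⁻¹`,
where `U`, `V` solve the linear Hamiltonian system `U' = -A U + B Bᵀ V`, `V' = Cᵀ C U + Aᵀ V`. If `U
T` kills `v`, the nondecreasing function `(U v) ⬝ᵥ (V v)` runs from a nonnegative value to `0`; so
it vanishes on `[0, T]`, which forces `Bᵀ V v = 0`, and `U v` solves `u' = -A u` with `u T = 0`,
whence `v = 0` (`isUnit_of_radon`). Uniqueness for the differential equation is a Grönwall estimate.
-/

theorem tendsto_pow_zero_of_spectralRadius_lt_one {A : Type*} [NormedRing A] [NormedAlgebra ℂ A]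
    [CompleteSpace A] {a : A} (h : spectralRadius ℂ a < 1) :
    Tendsto (fun k : ℕ => a ^ k) atTop (𝓝 0) := by
  obtain ⟨r, har, hr⟩ := ENNReal.lt_iff_exists_nnreal_btwn.1 h
  have hr1 : r < 1 := by exact_mod_cast hr
  have hev : ∀ᶠ k : ℕ in atTop, ‖a ^ k‖ ≤ (r : ℝ) ^ k := by
    filter_upwards [(spectrum.pow_nnnorm_pow_one_div_tendsto_nhds_spectralRadius a).eventually_lt_const
      har, eventually_gt_atTop 0] with k hk hk0
    have hk' : (0 : ℝ) < k := by exact_mod_cast hk0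
    rw [one_div, ENNReal.rpow_inv_lt_iff hk', ENNReal.rpow_natCast] at hk
    exact_mod_cast hk.le
  refine squeeze_zero_norm' hev ?_
  exact tendsto_pow_atTop_nhds_zero_of_lt_one r.2 (by exact_mod_cast hr1)

theorem Matrix.tendsto_pow_zero_of_spectrum {n : ℕ} {M : Matrix (Fin n) (Fin n) ℂ}
    (h : ∀ z ∈ spectrum ℂ M, ‖z‖ < 1) : Tendsto (fun k : ℕ => M ^ k) atTop (𝓝 0) := by
  rcases isEmpty_or_nonempty (Fin n) with hn | hn
  · exact tendsto_const_nhds.congr fun k => Subsingleton.elim _ _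
  · open scoped Norms.Operator in
    exact tendsto_pow_zero_of_spectralRadius_lt_one
      (spectrum.spectralRadius_lt_of_forall_lt (A := Matrix (Fin n) (Fin n) ℂ) M (r := 1) h)

/-! ### Eigenvectors and stable matrices -/

theorem Matrix.mem_spectrum_iff_exists_mulVec {n : ℕ} {M : Matrix (Fin n) (Fin n) ℂ} {z : ℂ} :
    z ∈ spectrum ℂ M ↔ ∃ v : Fin n → ℂ, v ≠ 0 ∧ M *ᵥ v = z • v := by
  rw [spectrum.mem_iff, Matrix.isUnit_iff_isUnit_det, isUnit_iff_ne_zero, not_not,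
    ← Matrix.exists_mulVec_eq_zero_iff]
  simp only [Algebra.algebraMap_eq_smul_one, Matrix.sub_mulVec, Matrix.smul_mulVec,
    Matrix.one_mulVec, sub_eq_zero, eq_comm]

/-- The complexification of a real matrix. -/
noncomputable abbrev Matrix.toComplex {m n : ℕ} (A : Matrix (Fin m) (Fin n) ℝ) :
    Matrix (Fin m) (Fin n) ℂ :=
  A.map (algebraMap ℝ ℂ)

theorem Matrix.toComplex_mul {l m n : ℕ} (A : Matrix (Fin l) (Fin m) ℝ)
    (B : Matrix (Fin m) (Fin n) ℝ) : (A * B).toComplex = A.toComplex * B.toComplex :=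
  Matrix.map_mul

theorem Matrix.toComplex_add {m n : ℕ} (A B : Matrix (Fin m) (Fin n) ℝ) :
    (A + B).toComplex = A.toComplex + B.toComplex :=
  Matrix.map_add _ (map_add _) A B

theorem Matrix.toComplex_sub {m n : ℕ} (A B : Matrix (Fin m) (Fin n) ℝ) :
    (A - B).toComplex = A.toComplex - B.toComplex :=
  Matrix.map_sub _ (map_sub _) A B

theorem Matrix.toComplex_neg {m n : ℕ} (A : Matrix (Fin m) (Fin n) ℝ) :
    (-A).toComplex = -A.toComplex := by
  ext; simp

theorem Matrix.toComplex_one {n : ℕ} :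
    (1 : Matrix (Fin n) (Fin n) ℝ).toComplex = 1 :=
  Matrix.map_one _ (map_zero _) (map_one _)

theorem Matrix.toComplex_zero {m n : ℕ} :
    (0 : Matrix (Fin m) (Fin n) ℝ).toComplex = 0 :=
  Matrix.map_zero _ (map_zero _)

theorem Matrix.toComplex_conjTranspose {m n : ℕ} (A : Matrix (Fin m) (Fin n) ℝ) :
    A.toComplexᴴ = (Aᵀ).toComplex := by
  ext; simp

theorem Matrix.toComplex_injective {m n : ℕ} :
    Function.Injective (Matrix.toComplex : Matrix (Fin m) (Fin n) ℝ → _) :=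
  Matrix.map_injective (algebraMap ℝ ℂ).injective

theorem Matrix.toComplex_pow {n : ℕ} (A : Matrix (Fin n) (Fin n) ℝ) (k : ℕ) :
    (A ^ k).toComplex = A.toComplex ^ k :=
  map_pow (algebraMap ℝ ℂ).mapMatrix A k

theorem isStableMatrix_iff {n : ℕ} {A : Matrix (Fin n) (Fin n) ℝ} :
    IsStableMatrix A ↔
      ∀ (z : ℂ) (v : Fin n → ℂ), v ≠ 0 → A.toComplex *ᵥ v = z • v → z.re < 0 := by
  simp only [IsStableMatrix, Matrix.mem_spectrum_iff_exists_mulVec]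
  exact ⟨fun h z v h0 hv => h z ⟨v, h0, hv⟩, fun h z ⟨v, h0, hv⟩ => h z v h0 hv⟩

theorem IsStableMatrix.transpose {n : ℕ} {A : Matrix (Fin n) (Fin n) ℝ} (hA : IsStableMatrix A) :
    IsStableMatrix Aᵀ := by
  intro z hz
  refine hA z ?_
  rw [Matrix.mem_spectrum_iff_isRoot_charpoly] at hz ⊢
  rwa [Matrix.transpose_map, Matrix.charpoly_transpose] at hz

/-! ### Sylvester and Lyapunov equations with stable coefficients -/

theorem Matrix.aeval_mul_eq_mul_aeval {n : ℕ} {M N D : Matrix (Fin n) (Fin n) ℂ}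
    (h : M * D = D * N) (p : Polynomial ℂ) :
    Polynomial.aeval M p * D = D * Polynomial.aeval N p := by
  induction p using Polynomial.induction_on' with
  | add p q hp hq => simp only [map_add, add_mul, mul_add, hp, hq]
  | monomial k c =>
    have hk : M ^ k * D = D * N ^ k := (SemiconjBy.pow_right (a := D) h.symm k).symm
    simp only [Polynomial.aeval_monomial, Algebra.algebraMap_eq_smul_one, smul_mul_assoc, one_mul,
      mul_smul_comm, hk]

/-- With `p` the characteristic polynomial of `F`, Cayley–Hamilton and `F * D = D * (-G)` give `0 =
p(F) * D = D * p(-G)`. The spectra of `F` and `-G` lie in opposite open half-planes, so `p(-G)` is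
invertible. -/
theorem IsStableMatrix.eq_zero_of_sylvester {n : ℕ} {F G D : Matrix (Fin n) (Fin n) ℝ}
    (hF : IsStableMatrix F) (hG : IsStableMatrix G) (h : F * D + D * G = 0) : D = 0 := by
  rcases Nat.eq_zero_or_pos n with rfl | hn
  · exact Subsingleton.elim _ _
  apply Matrix.toComplex_injective
  rw [Matrix.toComplex_zero]
  have hc : F.toComplex * D.toComplex = D.toComplex * (-G.toComplex) := by
    rw [← Matrix.toComplex_neg, ← Matrix.toComplex_mul, ← Matrix.toComplex_mul,
      eq_neg_of_add_eq_zero_left h, mul_neg]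
  have hp := Matrix.aeval_mul_eq_mul_aeval hc F.toComplex.charpoly
  rw [Matrix.aeval_self_charpoly, zero_mul] at hp
  have hu : IsUnit (Polynomial.aeval (-G.toComplex) F.toComplex.charpoly) := by
    by_contra hu
    rw [← spectrum.zero_mem_iff ℂ, spectrum.map_polynomial_aeval_of_degree_pos _ _
      (by rw [Matrix.charpoly_degree_eq_dim]; simpa using hn)] at hu
    obtain ⟨z, hz, hz0⟩ := hu
    have h1 := hF z (Matrix.mem_spectrum_iff_isRoot_charpoly.2 hz0)
    have h2 := hG (-z) (by rwa [← Set.mem_neg, spectrum.neg_eq])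
    simp only [Complex.neg_re] at h2
    linarith
  exact (hu.mul_left_eq_zero).1 hp.symm

theorem IsStableMatrix.exists_sylvester {n : ℕ} {F G : Matrix (Fin n) (Fin n) ℝ}
    (hF : IsStableMatrix F) (hG : IsStableMatrix G) (Q : Matrix (Fin n) (Fin n) ℝ) :
    ∃ X : Matrix (Fin n) (Fin n) ℝ, F * X + X * G + Q = 0 := by
  let T : Matrix (Fin n) (Fin n) ℝ →ₗ[ℝ] Matrix (Fin n) (Fin n) ℝ :=
    LinearMap.mulLeft ℝ F + LinearMap.mulRight ℝ G
  have hT : Function.Injective T :=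
    (injective_iff_map_eq_zero T).2 fun D hD => hF.eq_zero_of_sylvester hG hD
  obtain ⟨X, hX⟩ := LinearMap.injective_iff_surjective.1 hT (-Q)
  exact ⟨X, by rw [show F * X + X * G = -Q from hX, neg_add_cancel]⟩

theorem IsStableMatrix.isUnit_one_sub {n : ℕ} {F : Matrix (Fin n) (Fin n) ℝ}
    (hF : IsStableMatrix F) : IsUnit (1 - F) := by
  rw [Matrix.isUnit_iff_isUnit_det, isUnit_iff_ne_zero]
  intro h
  obtain ⟨v, hv0, hv⟩ := Matrix.exists_mulVec_eq_zero_iff.2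
    (show (1 - F).toComplex.det = 0 by
      rw [Matrix.toComplex, ← RingHom.mapMatrix_apply, ← RingHom.map_det, h, map_zero])
  rw [Matrix.toComplex_sub, Matrix.toComplex_one, Matrix.sub_mulVec, Matrix.one_mulVec,
    sub_eq_zero] at hv
  have := isStableMatrix_iff.1 hF 1 v hv0 (by rw [one_smul, ← hv])
  norm_num at this

theorem Complex.norm_lt_one_of_re_neg {z w : ℂ} (h : z * (1 - w) = 1 + w) (hw : w.re < 0) :
    ‖z‖ < 1 := by
  have h1 : ‖1 + w‖ < ‖1 - w‖ := by
    rw [← sq_lt_sq₀ (norm_nonneg _) (norm_nonneg _), ← Complex.normSq_eq_norm_sq,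
      ← Complex.normSq_eq_norm_sq, Complex.normSq_apply, Complex.normSq_apply]
    simp only [Complex.add_re, Complex.one_re, Complex.add_im, Complex.one_im, Complex.sub_re,
      Complex.sub_im]
    nlinarith
  rw [← h, norm_mul] at h1
  by_contra! hz
  nlinarith [norm_nonneg (1 - w)]

/-- Powers of the Cayley transform of a stable matrix tend to zero. -/
theorem IsStableMatrix.tendsto_cayley_pow {n : ℕ} {F : Matrix (Fin n) (Fin n) ℝ}
    (hF : IsStableMatrix F) :
    Tendsto (fun k : ℕ => ((1 + F) * (1 - F)⁻¹) ^ k) atTop (𝓝 0) := by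
  have hdet := (Matrix.isUnit_iff_isUnit_det _).1 hF.isUnit_one_sub
  have hc : Tendsto (fun k : ℕ => ((1 + F) * (1 - F)⁻¹).toComplex ^ k) atTop (𝓝 0) := by
    refine Matrix.tendsto_pow_zero_of_spectrum fun z hz => ?_
    obtain ⟨v, hv0, hv⟩ := Matrix.mem_spectrum_iff_exists_mulVec.1 hz
    have hinv : (1 - F).toComplex * ((1 - F)⁻¹).toComplex = 1 := by
      rw [← Matrix.toComplex_mul, Matrix.mul_nonsing_inv _ hdet, Matrix.toComplex_one]
    obtain ⟨u, rfl⟩ : ∃ u, v = (1 - F).toComplex *ᵥ u :=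
      -- In terms of `u`, an eigenvector of the Cayley transform for `z` becomes one of `F` for `(z
      -- - 1) / (z + 1)`.
      ⟨((1 - F)⁻¹).toComplex *ᵥ v, by rw [Matrix.mulVec_mulVec, hinv, Matrix.one_mulVec]⟩
    have hu0 : u ≠ 0 := by rintro rfl; exact hv0 (Matrix.mulVec_zero _)
    rw [Matrix.mulVec_mulVec, ← Matrix.toComplex_mul, Matrix.mul_assoc,
      Matrix.nonsing_inv_mul _ hdet, Matrix.mul_one, Matrix.toComplex_add, Matrix.toComplex_sub,
      Matrix.toComplex_one, Matrix.add_mulVec, Matrix.sub_mulVec, Matrix.one_mulVec] at hv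
    have hz1 : z + 1 ≠ 0 := by
      intro hz1
      apply hu0
      rw [eq_neg_of_add_eq_zero_left hz1, smul_sub, neg_smul, neg_smul, one_smul, one_smul] at hv
      have h2 : (2 : ℂ) • u = 0 := by
        rw [two_smul]; linear_combination (exp := 1) hv
      exact (smul_eq_zero.1 h2).resolve_left two_ne_zero
    have hw : F.toComplex *ᵥ u = ((z - 1) / (z + 1)) • u := by
      have h3 : (z + 1) • (F.toComplex *ᵥ u) = (z - 1) • u := by
        rw [smul_sub] at hv
        rw [add_smul, sub_smul, one_smul, one_smul]
        linear_combination (exp := 1) hv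
      rw [div_eq_inv_mul, mul_smul, ← h3, smul_smul, inv_mul_cancel₀ hz1, one_smul]
    refine Complex.norm_lt_one_of_re_neg ?_ (isStableMatrix_iff.1 hF _ u hu0 hw)
    field_simp
    ring
  have hre : Continuous fun M : Matrix (Fin n) (Fin n) ℂ => M.map Complex.re :=
    continuous_id.matrix_map Complex.continuous_re
  have h0 := (hre.tendsto 0).comp hc
  rw [Matrix.map_zero _ Complex.zero_re] at h0
  refine h0.congr fun k => ?_
  rw [Function.comp_apply, ← Matrix.toComplex_pow]
  ext i j
  simp

theorem IsStableMatrix.isHermitian_of_lyapunov {n : ℕ} {F X Q : Matrix (Fin n) (Fin n) ℝ}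
    (hF : IsStableMatrix F) (hQ : Q.IsHermitian) (h : Fᵀ * X + X * F + Q = 0) :
    X.IsHermitian := by
  have hQ' : Qᵀ = Q := by simpa [Matrix.IsHermitian] using hQ
  have ht : Xᵀ * F + Fᵀ * Xᵀ + Q = 0 := by
    simpa [Matrix.transpose_mul, hQ'] using congrArg Matrix.transpose h
  have := hF.transpose.eq_zero_of_sylvester hF (D := Xᵀ - X) (by
    linear_combination (norm := noncomm_ring) ht - h)
  rw [Matrix.IsHermitian, Matrix.conjTranspose_eq_transpose_of_trivial]
  exact sub_eq_zero.1 this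

theorem Matrix.posSemidef_real_iff {n : ℕ} {M : Matrix (Fin n) (Fin n) ℝ} :
    M.PosSemidef ↔ M.IsHermitian ∧ ∀ x : Fin n → ℝ, 0 ≤ x ⬝ᵥ M *ᵥ x := by
  simp [Matrix.posSemidef_iff_dotProduct_mulVec]

theorem Matrix.dotProduct_congr_mulVec {n : ℕ} (G X : Matrix (Fin n) (Fin n) ℝ)
    (x : Fin n → ℝ) : x ⬝ᵥ (Gᵀ * X * G) *ᵥ x = (G *ᵥ x) ⬝ᵥ X *ᵥ (G *ᵥ x) := by
  rw [Matrix.mul_assoc, ← Matrix.mulVec_mulVec, ← Matrix.mulVec_mulVec, Matrix.dotProduct_mulVec,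
    Matrix.vecMul_transpose]

/-- The Cayley transform `G` turns the Lyapunov equation into a Stein equation, by which the form of
`X` does not increase under `G`. As `G ^ k` tends to `0`, the form at `x` is at least its limit `0`.
-/
theorem IsStableMatrix.posSemidef_of_lyapunov {n : ℕ} {F X Q : Matrix (Fin n) (Fin n) ℝ}
    (hF : IsStableMatrix F) (hQ : Q.PosSemidef) (h : Fᵀ * X + X * F + Q = 0) :
    X.PosSemidef := by
  refine Matrix.posSemidef_real_iff.2 ⟨hF.isHermitian_of_lyapunov hQ.1 h, fun x => ?_⟩
  have hdet := (Matrix.isUnit_iff_isUnit_det _).1 hF.isUnit_one_sub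
  have hlim := hF.tendsto_cayley_pow
  set Y := (1 - F)⁻¹ with hY
  set G := (1 + F) * Y with hG
  have hFY : (1 - F) * Y = 1 := Matrix.mul_nonsing_inv _ hdet
  have hYF : Yᵀ * (1 - F)ᵀ = 1 := by rw [← Matrix.transpose_mul, hFY, Matrix.transpose_one]
  have hstein : X = Gᵀ * X * G + (2 : ℝ) • (Yᵀ * Q * Y) := by
    have h1 : (1 - F)ᵀ * X * (1 - F) = (1 + F)ᵀ * X * (1 + F) + (2 : ℝ) • Q := by
      rw [Matrix.transpose_sub, Matrix.transpose_add, Matrix.transpose_one, two_smul]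
      linear_combination (norm := noncomm_ring) -h - h
    calc X = (Yᵀ * (1 - F)ᵀ) * X * ((1 - F) * Y) := by rw [hFY, hYF, one_mul, mul_one]
      _ = Yᵀ * ((1 - F)ᵀ * X * (1 - F)) * Y := by simp only [mul_assoc]
      _ = _ := by
        rw [h1, hG, Matrix.transpose_mul, mul_add, add_mul, mul_smul_comm, smul_mul_assoc]
        simp only [mul_assoc]
  have hstep : ∀ y : Fin n → ℝ, (G *ᵥ y) ⬝ᵥ X *ᵥ (G *ᵥ y) ≤ y ⬝ᵥ X *ᵥ y := by
    intro y
    have h2 := (Matrix.posSemidef_real_iff.1 hQ).2 (Y *ᵥ y)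
    have h3 : y ⬝ᵥ X *ᵥ y = (G *ᵥ y) ⬝ᵥ X *ᵥ (G *ᵥ y) + 2 * ((Y *ᵥ y) ⬝ᵥ Q *ᵥ (Y *ᵥ y)) := by
      conv_lhs => rw [hstein]
      rw [Matrix.add_mulVec, dotProduct_add, Matrix.smul_mulVec, dotProduct_smul,
        Matrix.dotProduct_congr_mulVec, Matrix.dotProduct_congr_mulVec, smul_eq_mul]
    linarith
  have hpow : ∀ k : ℕ, ((G ^ k) *ᵥ x) ⬝ᵥ X *ᵥ ((G ^ k) *ᵥ x) ≤ x ⬝ᵥ X *ᵥ x := by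
    intro k
    induction k with
    | zero => simp
    | succ k ih =>
      rw [pow_succ', ← Matrix.mulVec_mulVec]
      exact (hstep _).trans ih
  have hcont : Continuous fun M : Matrix (Fin n) (Fin n) ℝ => (M *ᵥ x) ⬝ᵥ X *ᵥ (M *ᵥ x) := by
    fun_prop
  have := (hcont.tendsto 0).comp hlim
  simp only [Matrix.zero_mulVec, zero_dotProduct] at this
  exact le_of_tendsto' this hpow

/-! ### Positive semidefinite solutions of Lyapunov equations and unstable eigenvectors -/

theorem Matrix.PosSemidef.toComplex {n : ℕ} {X : Matrix (Fin n) (Fin n) ℝ} (hX : X.PosSemidef) :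
    open scoped ComplexOrder in X.toComplex.PosSemidef := by
  open scoped ComplexOrder MatrixOrder in
  obtain ⟨N, rfl⟩ := CStarAlgebra.nonneg_iff_eq_star_mul_self.1 hX.nonneg
  rw [Matrix.star_eq_conjTranspose, Matrix.conjTranspose_eq_transpose_of_trivial,
    Matrix.toComplex_mul, ← Matrix.toComplex_conjTranspose]
  exact Matrix.posSemidef_conjTranspose_mul_self _

/-- Sandwiching the equation between `star v` and `v` gives `2 Re(z) v*Xv + v*Qv = 0` with both
terms nonnegative. -/
theorem Matrix.PosSemidef.toComplex_mulVec_eq_zero_of_lyapunov {n : ℕ}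
    {F X Q : Matrix (Fin n) (Fin n) ℝ} (hX : X.PosSemidef) (hQ : Q.PosSemidef)
    (h : Fᵀ * X + X * F + Q = 0) {z : ℂ} {v : Fin n → ℂ} (hv : F.toComplex *ᵥ v = z • v)
    (hz : 0 ≤ z.re) : Q.toComplex *ᵥ v = 0 := by
  open scoped ComplexOrder in
  rw [← hQ.toComplex.dotProduct_mulVec_zero_iff]
  have hXv := Complex.le_def.1 (hX.toComplex.dotProduct_mulVec_nonneg v)
  have hQv := Complex.le_def.1 (hQ.toComplex.dotProduct_mulVec_nonneg v)
  have hc := congrArg (fun M => star v ⬝ᵥ M.toComplex *ᵥ v) h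
  simp only [Matrix.toComplex_add, Matrix.toComplex_mul, Matrix.toComplex_zero,
    ← Matrix.toComplex_conjTranspose, Matrix.add_mulVec, dotProduct_add, Matrix.zero_mulVec,
    dotProduct_zero, ← Matrix.mulVec_mulVec, hv, Matrix.mulVec_smul, dotProduct_smul] at hc
  rw [Matrix.dotProduct_mulVec, ← Matrix.star_mulVec, hv, star_smul, smul_dotProduct] at hc
  generalize star v ⬝ᵥ X.toComplex *ᵥ v = q at *
  generalize star v ⬝ᵥ Q.toComplex *ᵥ v = r at *
  have hre := congrArg Complex.re hc
  simp only [smul_eq_mul, Complex.add_re, Complex.mul_re, Complex.star_def, Complex.conj_re,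
    Complex.conj_im, Complex.zero_re, Complex.zero_im] at hre hXv hQv
  rw [← hXv.2] at hre
  apply Complex.ext
  · rw [Complex.zero_re]
    nlinarith [mul_nonneg hz hXv.1]
  · exact hQv.2.symm

theorem Matrix.PosSemidef.mulVec_eq_zero_of_add {n : ℕ} {P Q : Matrix (Fin n) (Fin n) ℝ}
    (hP : P.PosSemidef) (hQ : Q.PosSemidef) {v : Fin n → ℂ} (h : (P + Q).toComplex *ᵥ v = 0) :
    P.toComplex *ᵥ v = 0 ∧ Q.toComplex *ᵥ v = 0 := by
  open scoped ComplexOrder in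
  have h0 := congrArg (fun w => star v ⬝ᵥ w) h
  simp only [Matrix.toComplex_add, Matrix.add_mulVec, dotProduct_add, dotProduct_zero] at h0
  have h1 := hP.toComplex.dotProduct_mulVec_nonneg v
  have h2 := hQ.toComplex.dotProduct_mulVec_nonneg v
  rw [← hP.toComplex.dotProduct_mulVec_zero_iff, ← hQ.toComplex.dotProduct_mulVec_zero_iff]
  exact (add_eq_zero_iff_of_nonneg h1 h2).1 h0

theorem Matrix.posSemidef_transpose_mul_self {m n : ℕ} (P : Matrix (Fin m) (Fin n) ℝ) :
    (Pᵀ * P).PosSemidef := by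
  simpa using Matrix.posSemidef_conjTranspose_mul_self P

theorem Matrix.toComplex_mulVec_eq_zero_of_transpose_mul_self {m n : ℕ}
    {P : Matrix (Fin m) (Fin n) ℝ} {v : Fin n → ℂ} (h : (Pᵀ * P).toComplex *ᵥ v = 0) :
    P.toComplex *ᵥ v = 0 := by
  rw [Matrix.toComplex_mul, ← Matrix.toComplex_conjTranspose] at h
  open scoped ComplexOrder in
  exact (Matrix.conjTranspose_mul_self_mulVec_eq_zero _ _).1 h

section Riccati

/-! ### Uniqueness and definiteness of the stabilizing solution -/

variable {n b c : ℕ} {A : Matrix (Fin n) (Fin n) ℝ} {B : Matrix (Fin n) (Fin b) ℝ}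
  {C : Matrix (Fin c) (Fin n) ℝ} {X Y : Matrix (Fin n) (Fin n) ℝ}

theorem Matrix.PosSemidef.transpose_eq (hX : X.PosSemidef) : Xᵀ = X := by
  simpa [Matrix.IsHermitian] using hX.1

theorem IsStabilizingARESolution.transpose_eq (hX : IsStabilizingARESolution A B C X) :
    Xᵀ = X := by
  obtain ⟨h, hs⟩ := hX
  have ht := congrArg Matrix.transpose h
  simp only [riccatiOp, Matrix.transpose_add, Matrix.transpose_sub, Matrix.transpose_mul,
    Matrix.transpose_transpose, Matrix.transpose_zero, Matrix.mul_assoc] at h ht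
  rw [← sub_eq_zero]
  refine hs.transpose.eq_zero_of_sylvester hs ?_
  simp only [closedLoop, Matrix.transpose_sub, Matrix.transpose_mul, Matrix.transpose_transpose,
    Matrix.mul_sub, Matrix.sub_mul, Matrix.mul_assoc]
  linear_combination (norm := abel) ht - h

/-- The difference of the two Riccati equations is a Sylvester equation for `X - Y` whose
coefficients are the two closed loops, the first transposed. -/
theorem IsStabilizingARESolution.eq (hX : IsStabilizingARESolution A B C X)
    (hY : IsStabilizingARESolution A B C Y) : X = Y := by
  have hXt := hX.transpose_eq
  obtain ⟨h, hs⟩ := hX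
  obtain ⟨h', hs'⟩ := hY
  simp only [riccatiOp, Matrix.mul_assoc] at h h'
  rw [← sub_eq_zero]
  refine hs.transpose.eq_zero_of_sylvester hs' ?_
  simp only [closedLoop, Matrix.transpose_sub, Matrix.transpose_mul, Matrix.transpose_transpose,
    Matrix.mul_sub, Matrix.sub_mul, Matrix.mul_assoc, hXt]
  linear_combination (norm := abel) h - h'

theorem IsStabilizingARESolution.posSemidef (hX : IsStabilizingARESolution A B C X) :
    X.PosSemidef := by
  have hXt := hX.transpose_eq
  obtain ⟨h, hs⟩ := hX
  refine hs.posSemidef_of_lyapunov ((Matrix.posSemidef_transpose_mul_self C).add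
    (Matrix.posSemidef_transpose_mul_self (Bᵀ * X))) ?_
  simp only [riccatiOp, closedLoop, Matrix.transpose_sub, Matrix.transpose_mul,
    Matrix.transpose_transpose, Matrix.mul_sub, Matrix.sub_mul, Matrix.mul_assoc, hXt] at h ⊢
  linear_combination (norm := abel) h

/-- An eigenvector with `0 ≤ z.re` would be killed by `C` and by `Bᵀ * X`, hence be an eigenvector
of `A - L * C` for the same `z`. -/
theorem IsDetectable.isStableMatrix_closedLoop (hAC : IsDetectable A C) (hX : X.PosSemidef)
    (h : riccatiOp A B C X = 0) : IsStableMatrix (closedLoop A B X) := by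
  obtain ⟨L, hL⟩ := hAC
  have hXt := hX.transpose_eq
  have hlyap : (closedLoop A B X)ᵀ * X + X * closedLoop A B X +
      (Cᵀ * C + (Bᵀ * X)ᵀ * (Bᵀ * X)) = 0 := by
    simp only [riccatiOp, closedLoop, Matrix.transpose_sub, Matrix.transpose_mul,
      Matrix.transpose_transpose, Matrix.mul_sub, Matrix.sub_mul, Matrix.mul_assoc, hXt] at h ⊢
    linear_combination (norm := abel) h
  have hC := Matrix.posSemidef_transpose_mul_self C
  have hB := Matrix.posSemidef_transpose_mul_self (Bᵀ * X)
  rw [isStableMatrix_iff]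
  intro z v hv0 hv
  by_contra! hz
  obtain ⟨h1, h2⟩ := hC.mulVec_eq_zero_of_add hB
    (hX.toComplex_mulVec_eq_zero_of_lyapunov (hC.add hB) hlyap hv hz)
  replace h1 := Matrix.toComplex_mulVec_eq_zero_of_transpose_mul_self h1
  replace h2 := Matrix.toComplex_mulVec_eq_zero_of_transpose_mul_self h2
  refine hz.not_gt (isStableMatrix_iff.1 hL z v hv0 ?_)
  rw [closedLoop, Matrix.mul_assoc, Matrix.toComplex_sub, Matrix.toComplex_mul B,
    Matrix.sub_mulVec, ← Matrix.mulVec_mulVec, h2, Matrix.mulVec_zero, sub_zero] at hv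
  rw [Matrix.toComplex_sub, Matrix.toComplex_mul, Matrix.sub_mulVec, ← Matrix.mulVec_mulVec, h1,
    Matrix.mulVec_zero, sub_zero, hv]

/-! ### Policy iteration and existence of the stabilizing solution -/

/-- `X` is the cost matrix of the stabilizing feedback `u = -K x`. -/
def IsFeedbackCost (A : Matrix (Fin n) (Fin n) ℝ) (B : Matrix (Fin n) (Fin b) ℝ)
    (C : Matrix (Fin c) (Fin n) ℝ) (K : Matrix (Fin b) (Fin n) ℝ)
    (X : Matrix (Fin n) (Fin n) ℝ) : Prop :=
  IsStableMatrix (A - B * K) ∧ (A - B * K)ᵀ * X + X * (A - B * K) + (Cᵀ * C + Kᵀ * K) = 0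

variable {K : Matrix (Fin b) (Fin n) ℝ}

theorem IsFeedbackCost.posSemidef (h : IsFeedbackCost A B C K X) : X.PosSemidef :=
  h.1.posSemidef_of_lyapunov ((Matrix.posSemidef_transpose_mul_self C).add
    (Matrix.posSemidef_transpose_mul_self K)) h.2

theorem IsStableMatrix.exists_isFeedbackCost (h : IsStableMatrix (A - B * K)) :
    ∃ X, IsFeedbackCost A B C K X :=
  (h.transpose.exists_sylvester h _).imp fun _ hX => ⟨h, hX⟩

/-- Completing the square in the cost equation leaves the extra term `(Bᵀ * X - K)ᵀ * (Bᵀ * X - K)`.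
It kills every unstable eigenvector of the new loop, so the old loop would share that eigenvector.
-/
theorem IsFeedbackCost.isStableMatrix_improved (h : IsFeedbackCost A B C K X) :
    IsStableMatrix (A - B * (Bᵀ * X)) := by
  have hX := h.posSemidef
  have hXt := hX.transpose_eq
  obtain ⟨hs, h⟩ := h
  have hlyap : (A - B * (Bᵀ * X))ᵀ * X + X * (A - B * (Bᵀ * X)) +
      ((Cᵀ * C + (Bᵀ * X)ᵀ * (Bᵀ * X)) + (Bᵀ * X - K)ᵀ * (Bᵀ * X - K)) = 0 := by
    simp only [Matrix.transpose_sub, Matrix.transpose_mul, Matrix.transpose_transpose,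
      Matrix.mul_sub, Matrix.sub_mul, Matrix.mul_assoc, hXt] at h ⊢
    linear_combination (norm := abel) h
  have hP := (Matrix.posSemidef_transpose_mul_self C).add
    (Matrix.posSemidef_transpose_mul_self (Bᵀ * X))
  have hD := Matrix.posSemidef_transpose_mul_self (Bᵀ * X - K)
  rw [isStableMatrix_iff]
  intro z v hv0 hv
  by_contra! hz
  have h1 := (hP.mulVec_eq_zero_of_add hD
    (hX.toComplex_mulVec_eq_zero_of_lyapunov (hP.add hD) hlyap hv hz)).2
  replace h1 := Matrix.toComplex_mulVec_eq_zero_of_transpose_mul_self h1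
  refine hz.not_gt (isStableMatrix_iff.1 hs z v hv0 ?_)
  rw [show A - B * K = (A - B * (Bᵀ * X)) + B * (Bᵀ * X - K) by rw [Matrix.mul_sub]; abel,
    Matrix.toComplex_add, Matrix.toComplex_mul B (_ - _), Matrix.add_mulVec,
    ← Matrix.mulVec_mulVec, h1, Matrix.mulVec_zero, add_zero, hv]

theorem IsFeedbackCost.posSemidef_sub_improved (h : IsFeedbackCost A B C K X)
    (hY : IsFeedbackCost A B C (Bᵀ * X) Y) : (X - Y).PosSemidef := by
  have hXt := h.posSemidef.transpose_eq
  refine hY.1.posSemidef_of_lyapunov (Matrix.posSemidef_transpose_mul_self (Bᵀ * X - K)) ?_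
  obtain ⟨-, h⟩ := h
  obtain ⟨-, hY⟩ := hY
  simp only [Matrix.transpose_sub, Matrix.transpose_mul, Matrix.transpose_transpose,
    Matrix.mul_sub, Matrix.sub_mul, Matrix.mul_assoc, hXt] at h hY ⊢
  linear_combination (norm := abel) h - hY

theorem Matrix.posSemidef_of_tendsto {Z : ℕ → Matrix (Fin n) (Fin n) ℝ}
    (h : Tendsto Z atTop (𝓝 X)) (hZ : ∀ k, (Z k).PosSemidef) : X.PosSemidef := by
  refine Matrix.posSemidef_real_iff.2 ⟨?_, fun x => ?_⟩
  · have ht : Continuous fun M : Matrix (Fin n) (Fin n) ℝ => Mᴴ := by fun_prop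
    exact tendsto_nhds_unique (((ht.tendsto X).comp h).congr fun k => (hZ k).1) h
  · have hq : Continuous fun M : Matrix (Fin n) (Fin n) ℝ => x ⬝ᵥ M *ᵥ x := by fun_prop
    exact ge_of_tendsto' ((hq.tendsto X).comp h) fun k => (Matrix.posSemidef_real_iff.1 (hZ k)).2 x

/-- A decreasing sequence of positive semidefinite matrices converges. -/
theorem Matrix.exists_tendsto_of_posSemidef_sub {Z : ℕ → Matrix (Fin n) (Fin n) ℝ}
    (hZ : ∀ k, (Z k).PosSemidef) (hsub : ∀ k, (Z k - Z (k + 1)).PosSemidef) :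
    ∃ X, Tendsto Z atTop (𝓝 X) := by
  have hq : ∀ x : Fin n → ℝ, ∃ l, Tendsto (fun k => x ⬝ᵥ Z k *ᵥ x) atTop (𝓝 l) := by
    intro x
    refine ⟨_, tendsto_atTop_ciInf (antitone_nat_of_succ_le fun k => ?_) ⟨0, ?_⟩⟩
    · have := (Matrix.posSemidef_real_iff.1 (hsub k)).2 x
      rw [Matrix.sub_mulVec, dotProduct_sub] at this
      linarith
    · rintro _ ⟨k, rfl⟩
      exact (Matrix.posSemidef_real_iff.1 (hZ k)).2 x
  choose q hq using hq
  let e : Fin n → Fin n → ℝ := fun i => Pi.single i 1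
  -- The entries of the limit come from the limits of the quadratic forms by polarization.
  refine ⟨Matrix.of fun i j => (q (e i + e j) - q (e i) - q (e j)) / 2, ?_⟩
  refine tendsto_pi_nhds.2 fun i => tendsto_pi_nhds.2 fun j => ?_
  refine ((((hq (e i + e j)).sub (hq (e i))).sub (hq (e j))).div_const 2).congr fun k => ?_
  have hsymm : Z k j i = Z k i j := congrFun (congrFun (hZ k).transpose_eq i) j
  simp only [e, Matrix.mulVec_add, dotProduct_add, add_dotProduct, Matrix.mulVec_single_one,
    single_one_dotProduct, Matrix.col_apply, hsymm]
  ring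

theorem exists_isStabilizingARESolution (hAB : IsStabilizable A B) (hAC : IsDetectable A C) :
    ∃ X, IsStabilizingARESolution A B C X := by
  have hstep : ∀ X : {X // ∃ K, IsFeedbackCost A B C K X},
      ∃ Y : {X // ∃ K, IsFeedbackCost A B C K X}, IsFeedbackCost A B C (Bᵀ * X.1) Y.1 := by
    rintro ⟨X, K, h⟩
    obtain ⟨Y, hY⟩ := h.isStableMatrix_improved.exists_isFeedbackCost (C := C)
    exact ⟨⟨Y, _, hY⟩, hY⟩
  choose f hf using hstep
  obtain ⟨K₀, hK₀⟩ := hAB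
  obtain ⟨Z₀, hZ₀⟩ := hK₀.exists_isFeedbackCost (C := C)
  let Z : ℕ → {X // ∃ K, IsFeedbackCost A B C K X} := fun k => f^[k] ⟨Z₀, K₀, hZ₀⟩
  have hsucc : ∀ k, IsFeedbackCost A B C (Bᵀ * (Z k).1) (Z (k + 1)).1 := by
    intro k
    simp only [Z, Function.iterate_succ_apply']
    exact hf _
  have hpos : ∀ k, (Z k).1.PosSemidef := fun k => (Z k).2.choose_spec.posSemidef
  obtain ⟨X, hX⟩ := Matrix.exists_tendsto_of_posSemidef_sub hpos
    fun k => (Z k).2.choose_spec.posSemidef_sub_improved (hsucc k)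
  have hXpos := Matrix.posSemidef_of_tendsto hX hpos
  have hcont : Continuous fun p : Matrix (Fin n) (Fin n) ℝ × Matrix (Fin n) (Fin n) ℝ =>
      (A - B * (Bᵀ * p.1))ᵀ * p.2 + p.2 * (A - B * (Bᵀ * p.1)) +
        (Cᵀ * C + (Bᵀ * p.1)ᵀ * (Bᵀ * p.1)) := by fun_prop
  -- The cost equation couples consecutive iterates; both tend to `X`, and the limit equation is the
  -- Riccati equation.
  have hlim := (hcont.tendsto (X, X)).comp (hX.prodMk_nhds (hX.comp (tendsto_add_atTop_nat 1)))
  have h0 := tendsto_nhds_unique (tendsto_const_nhds.congr fun k => (hsucc k).2.symm) hlim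
  have hric : riccatiOp A B C X = 0 := by
    simp only [riccatiOp, Matrix.transpose_sub, Matrix.transpose_mul, Matrix.transpose_transpose,
      Matrix.mul_sub, Matrix.sub_mul, Matrix.mul_assoc, hXpos.transpose_eq] at h0 ⊢
    linear_combination (norm := abel) -h0
  exact ⟨X, hric, hAC.isStableMatrix_closedLoop hXpos hric⟩

end Riccati

/-! ### Derivatives of matrix-valued functions -/

section MatrixDeriv

open scoped Matrix.Norms.Operator

variable {n : ℕ} {M N : ℝ → Matrix (Fin n) (Fin n) ℝ} {M' N' : Matrix (Fin n) (Fin n) ℝ} {t : ℝ}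

/-- These wrappers carry calculus rules, proved with the norm local to this section, to places where
no matrix norm is in scope. -/
theorem HasDerivAt.matrix_mul (hM : HasDerivAt M M' t) (hN : HasDerivAt N N' t) :
    HasDerivAt (fun s => M s * N s) (M' * N t + M t * N') t :=
  hM.mul hN

theorem hasDerivAt_matrix_const (D : Matrix (Fin n) (Fin n) ℝ) (t : ℝ) :
    HasDerivAt (fun _ : ℝ => D) 0 t :=
  hasDerivAt_const t D

theorem HasDerivAt.matrix_sub (hM : HasDerivAt M M' t) (hN : HasDerivAt N N' t) :
    HasDerivAt (fun s => M s - N s) (M' - N') t :=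
  hM.sub hN

theorem HasDerivAt.matrix_congr_deriv (hM : HasDerivAt M M' t) (h : M' = N') :
    HasDerivAt M N' t :=
  h ▸ hM

theorem HasDerivAt.matrix_hasDerivWithinAt {S : Set ℝ} (hM : HasDerivAt M M' t) :
    HasDerivWithinAt M M' S t :=
  hM.hasDerivWithinAt

theorem HasDerivAt.matrix_inv (hM : HasDerivAt M M' t) (hu : IsUnit (M t)) :
    HasDerivAt (fun s => (M s)⁻¹) (-((M t)⁻¹ * M' * (M t)⁻¹)) t := by
  obtain ⟨u, hu⟩ := hu
  have h := (hu ▸ hasFDerivAt_ringInverse (𝕜 := ℝ) u :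
    HasFDerivAt Ring.inverse _ (M t)).comp_hasDerivAt t hM
  simp only [Matrix.nonsing_inv_eq_ringInverse]
  rw [← hu, Ring.inverse_unit]
  exact h

theorem HasDerivAt.matrix_linear {E : Type*} [NormedAddCommGroup E] [NormedSpace ℝ E]
    (L : Matrix (Fin n) (Fin n) ℝ →ₗ[ℝ] E) (hM : HasDerivAt M M' t) :
    HasDerivAt (fun s => L (M s)) (L M') t :=
  (LinearMap.toContinuousLinearMap L).hasFDerivAt.comp_hasDerivAt t hM

theorem HasDerivAt.matrix_mulVec (hM : HasDerivAt M M' t) (v : Fin n → ℝ) :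
    HasDerivAt (fun s => M s *ᵥ v) (M' *ᵥ v) t :=
  hM.matrix_linear ((Matrix.mulVecBilin ℝ ℝ).flip v)

theorem HasDerivAt.matrix_transpose (hM : HasDerivAt M M' t) :
    HasDerivAt (fun s => (M s)ᵀ) M'ᵀ t :=
  hM.matrix_linear (Matrix.transposeLinearEquiv (Fin n) (Fin n) ℝ ℝ).toLinearMap

theorem Matrix.hasDerivAt_exp_smul (F : Matrix (Fin n) (Fin n) ℝ) (t : ℝ) :
    HasDerivAt (fun s : ℝ => NormedSpace.exp (s • F)) (NormedSpace.exp (t • F) * F) t :=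
  hasDerivAt_exp_smul_const F t

theorem Matrix.hasDerivAt_exp_smul' (F : Matrix (Fin n) (Fin n) ℝ) (t : ℝ) :
    HasDerivAt (fun s : ℝ => NormedSpace.exp (s • F)) (F * NormedSpace.exp (t • F)) t :=
  hasDerivAt_exp_smul_const' F t

theorem Matrix.exp_neg_mul_exp (F : Matrix (Fin n) (Fin n) ℝ) :
    NormedSpace.exp (-F) * NormedSpace.exp F = 1 := by
  rw [← Matrix.exp_add_of_commute _ _ (Commute.refl F).neg_left, neg_add_cancel,
    NormedSpace.exp_zero]

end MatrixDeriv

/-! ### The Radon transform of the Riccati equation -/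

section Radon

variable {n b c : ℕ} {A : Matrix (Fin n) (Fin n) ℝ} {B : Matrix (Fin n) (Fin b) ℝ}
  {C : Matrix (Fin c) (Fin n) ℝ} {U V : ℝ → Matrix (Fin n) (Fin n) ℝ}

theorem hasDerivAt_radon_quadratic
    (hU : ∀ t, HasDerivAt U (-(A * U t) + B * (Bᵀ * V t)) t)
    (hV : ∀ t, HasDerivAt V (Cᵀ * (C * U t) + Aᵀ * V t) t) (v : Fin n → ℝ) (t : ℝ) :
    HasDerivAt (fun s => (U s *ᵥ v) ⬝ᵥ (V s *ᵥ v))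
      ((Bᵀ * V t) *ᵥ v ⬝ᵥ (Bᵀ * V t) *ᵥ v + (C * U t) *ᵥ v ⬝ᵥ (C * U t) *ᵥ v) t := by
  have key : ∀ {m : ℕ} (P Q : Matrix (Fin m) (Fin n) ℝ),
      v ⬝ᵥ (Pᵀ * Q) *ᵥ v = (P *ᵥ v) ⬝ᵥ (Q *ᵥ v) := by
    intro m P Q
    rw [← Matrix.mulVec_mulVec, Matrix.dotProduct_mulVec, Matrix.vecMul_transpose]
  have h := ((hU t).matrix_transpose.matrix_mul (hV t)).matrix_linear
    ((LinearMap.mk₂ ℝ (fun x y : Fin n → ℝ => x ⬝ᵥ y) add_dotProduct smul_dotProduct dotProduct_add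
      (fun c x y => dotProduct_smul c x y)) v ∘ₗ (Matrix.mulVecBilin ℝ ℝ).flip v)
  simp only [LinearMap.comp_apply, LinearMap.flip_apply, LinearMap.mk₂_apply,
    Matrix.mulVecBilin_apply, key] at h
  refine h.congr_deriv ?_
  rw [← key, ← key, ← dotProduct_add, ← Matrix.add_mulVec]
  congr 2
  simp only [Matrix.transpose_add, Matrix.transpose_mul, Matrix.transpose_neg,
    Matrix.transpose_transpose, Matrix.add_mul, Matrix.mul_add, Matrix.neg_mul, Matrix.mul_assoc]
  abel

theorem isUnit_of_radon
    (hU : ∀ t, HasDerivAt U (-(A * U t) + B * (Bᵀ * V t)) t)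
    (hV : ∀ t, HasDerivAt V (Cᵀ * (C * U t) + Aᵀ * V t) t)
    (hU0 : U 0 = 1) (hV0 : (V 0).PosSemidef) {T : ℝ} (hT : 0 ≤ T) : IsUnit (U T) := by
  rw [Matrix.isUnit_iff_isUnit_det, isUnit_iff_ne_zero]
  intro hdet
  obtain ⟨v, hv0, hv⟩ := Matrix.exists_mulVec_eq_zero_iff.2 hdet
  have hφ := hasDerivAt_radon_quadratic hU hV v
  set φ : ℝ → ℝ := fun s => (U s *ᵥ v) ⬝ᵥ (V s *ᵥ v) with hφdef
  have hnn : ∀ {m : ℕ} (w : Fin m → ℝ), 0 ≤ w ⬝ᵥ w := fun w =>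
    Finset.sum_nonneg fun i _ => mul_self_nonneg _
  have hmono : Monotone φ := monotone_of_deriv_nonneg (fun t => (hφ t).differentiableAt)
    fun t => by rw [(hφ t).deriv]; exact add_nonneg (hnn _) (hnn _)
  have hzero : ∀ t ∈ Set.Icc 0 T, φ t = 0 := by
    intro t ht
    have h0 : 0 ≤ φ 0 := by
      simpa [hφdef, hU0] using (Matrix.posSemidef_real_iff.1 hV0).2 v
    have hT0 : φ T = 0 := by simp [hφdef, hv]
    exact le_antisymm (hT0 ▸ hmono ht.2) (h0.trans (hmono ht.1))
  have hB : ∀ t ∈ Set.Ico 0 T, (Bᵀ * V t) *ᵥ v = 0 := by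
    intro t ht
    -- `φ` vanishes to the right of `t`, so its derivative there, a sum of two squares, is zero.
    have h1 : HasDerivWithinAt φ 0 (Set.Ici t) t := by
      refine (hasDerivWithinAt_const t _ (0 : ℝ)).congr_of_eventuallyEq ?_
        (hzero t ⟨ht.1, ht.2.le⟩)
      filter_upwards [Icc_mem_nhdsGE ht.2] with s hs
      exact hzero s ⟨ht.1.trans hs.1, hs.2⟩
    have h2 := (uniqueDiffWithinAt_Ici t).eq_deriv _ h1 (hφ t).hasDerivWithinAt
    exact dotProduct_self_eq_zero.1 ((add_eq_zero_iff_of_nonneg (hnn _) (hnn _)).1 h2.symm).1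
  -- The integrating factor `e^{tA}` removes the drift `-A U`, leaving only a term through `Bᵀ V v`.
  have hg : ∀ t, HasDerivAt (fun s => (NormedSpace.exp (s • A) * U s) *ᵥ v)
      ((NormedSpace.exp (t • A) * B) *ᵥ ((Bᵀ * V t) *ᵥ v)) t := by
    intro t
    convert ((Matrix.hasDerivAt_exp_smul A t).matrix_mul (hU t)).matrix_mulVec v using 1
    rw [Matrix.mulVec_mulVec]
    congr 1
    simp only [Matrix.mul_add, Matrix.mul_neg, Matrix.mul_assoc]
    abel
  have hconst := constant_of_has_deriv_right_zero (a := 0) (b := T)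
    (fun t _ => (hg t).continuousAt.continuousWithinAt)
    (fun t ht => by simpa only [hB t ht, Matrix.mulVec_zero] using (hg t).hasDerivWithinAt)
    T ⟨hT, le_rfl⟩
  rw [← Matrix.mulVec_mulVec, hv, Matrix.mulVec_zero, zero_smul, NormedSpace.exp_zero, one_mul,
    hU0, Matrix.one_mulVec] at hconst
  exact hv0 hconst.symm

end Radon

/-! ### The solution formula -/

section Formula

variable {n b c : ℕ} {A : Matrix (Fin n) (Fin n) ℝ} {B : Matrix (Fin n) (Fin b) ℝ}
  {C : Matrix (Fin c) (Fin n) ℝ} {F X X₀ Y : Matrix (Fin n) (Fin n) ℝ}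

theorem IsLyapunovSolution.hasDerivAt_formulaCore (hY : IsLyapunovSolution F B Y)
    (D : Matrix (Fin n) (Fin n) ℝ) (t : ℝ) :
    HasDerivAt (formulaCore F Y D)
      (-(NormedSpace.exp (t • F) * (B * (Bᵀ * (NormedSpace.exp (t • Fᵀ) * D))))) t := by
  have h := (hasDerivAt_matrix_const Y t).matrix_sub
    (((Matrix.hasDerivAt_exp_smul F t).matrix_mul (hasDerivAt_matrix_const Y t)).matrix_mul
      (Matrix.hasDerivAt_exp_smul' Fᵀ t))
  have h' := (hasDerivAt_matrix_const 1 t).matrix_sub (h.matrix_mul (hasDerivAt_matrix_const D t))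
  refine h'.matrix_congr_deriv ?_
  have hB := eq_neg_of_add_eq_zero_right hY
  rw [← Matrix.mul_assoc B, hB]
  noncomm_ring

theorem formulaCore_zero (F Y D : Matrix (Fin n) (Fin n) ℝ) : formulaCore F Y D 0 = 1 := by
  simp [formulaCore]

theorem IsStabilizingARESolution.isUnit_formulaCore (hX : IsStabilizingARESolution A B C X)
    (hX₀ : X₀.PosSemidef) (hY : IsLyapunovSolution (closedLoop A B X) B Y) {t : ℝ} (ht : 0 ≤ t) :
    IsUnit (formulaCore (closedLoop A B X) Y (X - X₀) t) := by
  have hXt := hX.transpose_eq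
  have hric := hX.1
  set F := closedLoop A B X with hF
  -- Chosen so that `U 0 = 1`, `V 0 = X₀` and the solution formula reads `V * U⁻¹`.
  let U : ℝ → Matrix (Fin n) (Fin n) ℝ := fun s =>
    NormedSpace.exp (s • -F) * formulaCore F Y (X - X₀) s
  let V : ℝ → Matrix (Fin n) (Fin n) ℝ := fun s =>
    X * U s - NormedSpace.exp (s • Fᵀ) * (X - X₀)
  have hU : ∀ s, HasDerivAt U (-(A * U s) + B * (Bᵀ * V s)) s := by
    intro s
    refine ((Matrix.hasDerivAt_exp_smul' (-F) s).matrix_mul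
      (hY.hasDerivAt_formulaCore (X - X₀) s)).matrix_congr_deriv ?_
    rw [mul_neg, ← mul_assoc (NormedSpace.exp (s • -F)), smul_neg, Matrix.exp_neg_mul_exp, one_mul,
      ← smul_neg, mul_assoc (-F)]
    change -F * U s + _ = _
    simp only [V, hF, closedLoop, Matrix.mul_sub, Matrix.sub_mul, Matrix.neg_mul, Matrix.mul_assoc]
    abel
  have hV : ∀ s, HasDerivAt V (Cᵀ * (C * U s) + Aᵀ * V s) s := by
    intro s
    refine (((hasDerivAt_matrix_const X s).matrix_mul (hU s)).matrix_sub
      ((Matrix.hasDerivAt_exp_smul' Fᵀ s).matrix_mul (hasDerivAt_matrix_const (X - X₀) s))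
        ).matrix_congr_deriv ?_
    have h0 := congrArg (· * U s) hric
    simp only [riccatiOp, V, hF, closedLoop, Matrix.transpose_sub, Matrix.transpose_mul,
      Matrix.transpose_transpose, hXt, Matrix.mul_sub, Matrix.sub_mul, Matrix.mul_add,
      Matrix.add_mul, Matrix.mul_neg, Matrix.mul_assoc, Matrix.mul_zero, Matrix.zero_mul] at h0 ⊢
    linear_combination (norm := abel) -h0
  have hunit := isUnit_of_radon hU hV (by simp [U, formulaCore_zero])
    (by simpa [V, U, formulaCore_zero] using hX₀) ht
  have hfac : formulaCore F Y (X - X₀) t = NormedSpace.exp (t • F) * U t := by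
    have := Matrix.exp_neg_mul_exp (-(t • F))
    rw [neg_neg, ← smul_neg] at this
    rw [← mul_assoc, this, one_mul]
  rw [hfac]
  exact (Matrix.isUnit_exp _).mul hunit

theorem IsStabilizingARESolution.isDRESolution_dreFormula
    (hX : IsStabilizingARESolution A B C X) (hX₀ : X₀.PosSemidef)
    (hY : IsLyapunovSolution (closedLoop A B X) B Y) :
    IsDRESolution A B C X₀ (dreFormula (closedLoop A B X) X Y X₀) := by
  refine ⟨by simp [dreFormula, formulaCore_zero], fun t ht => HasDerivAt.matrix_hasDerivWithinAt ?_⟩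
  have hXt := hX.transpose_eq
  have hunit := hX.isUnit_formulaCore hX₀ hY ht
  have hM := (hY.hasDerivAt_formulaCore (X - X₀) t).matrix_inv hunit
  have h := (hasDerivAt_matrix_const X t).matrix_sub
    ((((Matrix.hasDerivAt_exp_smul' (closedLoop A B X)ᵀ t).matrix_mul
    (hasDerivAt_matrix_const (X - X₀) t)).matrix_mul hM).matrix_mul
      (Matrix.hasDerivAt_exp_smul (closedLoop A B X) t))
  refine h.matrix_congr_deriv ?_
  have hP : dreFormula (closedLoop A B X) X Y X₀ t = X -
      NormedSpace.exp (t • (closedLoop A B X)ᵀ) * (X - X₀) *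
        (formulaCore (closedLoop A B X) Y (X - X₀) t)⁻¹ *
          NormedSpace.exp (t • closedLoop A B X) := rfl
  rw [hP]
  -- After differentiation only a noncommutative polynomial identity modulo the algebraic Riccati
  -- equation remains, so inverse and exponentials become arbitrary matrices.
  generalize formulaCore (closedLoop A B X) Y (X - X₀) t = M
  generalize X - X₀ = D
  generalize NormedSpace.exp (t • (closedLoop A B X)ᵀ) = E₁
  generalize NormedSpace.exp (t • closedLoop A B X) = E₂
  have hric := hX.1
  simp only [riccatiOp, closedLoop, Matrix.transpose_sub, Matrix.transpose_mul,
    Matrix.transpose_transpose, hXt, Matrix.mul_sub, Matrix.sub_mul, Matrix.add_mul, Matrix.mul_neg,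
    Matrix.neg_mul, Matrix.mul_assoc, Matrix.mul_zero,
    Matrix.zero_mul] at hric ⊢
  linear_combination (norm := abel) -hric

open scoped Matrix.Norms.Operator in
-- The difference of two solutions solves a linear equation whose coefficients are continuous, hence
-- bounded on `[0, t]`; Grönwall applies. No symmetry of the solutions is needed.
theorem IsDRESolution.eq {X Z : ℝ → Matrix (Fin n) (Fin n) ℝ} (hX : IsDRESolution A B C X₀ X)
    (hZ : IsDRESolution A B C X₀ Z) {t : ℝ} (ht : 0 ≤ t) : X t = Z t := by
  have hXc : ContinuousOn X (Set.Icc 0 t) := fun s hs =>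
    (hX.2 s hs.1).continuousWithinAt.mono Set.Icc_subset_Ici_self
  have hZc : ContinuousOn Z (Set.Icc 0 t) := fun s hs =>
    (hZ.2 s hs.1).continuousWithinAt.mono Set.Icc_subset_Ici_self
  have hG : ContinuousOn (fun s => Aᵀ - X s * (B * Bᵀ)) (Set.Icc 0 t) :=
    continuousOn_const.sub (hXc.mul continuousOn_const)
  have hH : ContinuousOn (fun s => A - B * Bᵀ * Z s) (Set.Icc 0 t) :=
    continuousOn_const.sub (continuousOn_const.mul hZc)
  obtain ⟨k, hk⟩ := isCompact_Icc.exists_bound_of_continuousOn hG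
  obtain ⟨l, hl⟩ := isCompact_Icc.exists_bound_of_continuousOn hH
  rw [← sub_eq_zero]
  refine eq_zero_of_abs_deriv_le_mul_abs_self_of_eq_zero_right (f := fun s => X s - Z s)
    (f' := fun s => riccatiOp A B C (X s) - riccatiOp A B C (Z s)) (K := k + l)
    (hXc.sub hZc) (fun s hs => ((hX.2 s hs.1).sub (hZ.2 s hs.1)).mono (Set.Ici_subset_Ici.2 hs.1))
    (by simp only [hX.1, hZ.1, sub_self]) (fun s hs => ?_) t ⟨ht, le_rfl⟩
  have hs' : s ∈ Set.Icc 0 t := ⟨hs.1, hs.2.le⟩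
  have hdiff : riccatiOp A B C (X s) - riccatiOp A B C (Z s) =
      (Aᵀ - X s * (B * Bᵀ)) * (X s - Z s) + (X s - Z s) * (A - B * Bᵀ * Z s) := by
    simp only [riccatiOp, Matrix.mul_sub, Matrix.sub_mul, Matrix.mul_assoc]
    abel
  rw [hdiff]
  refine (norm_add_le _ _).trans ?_
  have h1 := norm_mul_le (Aᵀ - X s * (B * Bᵀ)) (X s - Z s)
  have h2 := norm_mul_le (X s - Z s) (A - B * Bᵀ * Z s)
  nlinarith [mul_le_mul_of_nonneg_right (hk s hs') (norm_nonneg (X s - Z s)),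
    mul_le_mul_of_nonneg_left (hl s hs') (norm_nonneg (X s - Z s))]

theorem IsStableMatrix.existsUnique_isLyapunovSolution (hF : IsStableMatrix F) :
    ∃! Y, IsLyapunovSolution F B Y := by
  obtain ⟨Y, hY⟩ := hF.exists_sylvester hF.transpose (B * Bᵀ)
  refine ⟨Y, hY, fun Z hZ => sub_eq_zero.1 (hF.eq_zero_of_sylvester hF.transpose ?_)⟩
  simp only [IsLyapunovSolution] at hZ
  linear_combination (norm := noncomm_ring) hZ - hY

theorem IsStableMatrix.posSemidef_of_isLyapunovSolution (hF : IsStableMatrix F)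
    (hY : IsLyapunovSolution F B Y) : Y.PosSemidef :=
  hF.transpose.posSemidef_of_lyapunov
    (by simpa using Matrix.posSemidef_self_mul_conjTranspose B) hY

end Formula

theorem mainTheorem2 {n b c : ℕ}
    (A : Matrix (Fin n) (Fin n) ℝ) (B : Matrix (Fin n) (Fin b) ℝ) (C : Matrix (Fin c) (Fin n) ℝ)
    (X₀ : Matrix (Fin n) (Fin n) ℝ) (hX₀ : X₀.PosSemidef)
    (hAB : IsStabilizable A B) (hAC : IsDetectable A C) :
    (∃! Xinf : Matrix (Fin n) (Fin n) ℝ, IsStabilizingARESolution A B C Xinf) ∧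
    ∀ Xinf : Matrix (Fin n) (Fin n) ℝ, IsStabilizingARESolution A B C Xinf →
      Xinf.PosSemidef ∧
      (∃! XL : Matrix (Fin n) (Fin n) ℝ, IsLyapunovSolution (closedLoop A B Xinf) B XL) ∧
      ∀ XL : Matrix (Fin n) (Fin n) ℝ, IsLyapunovSolution (closedLoop A B Xinf) B XL →
        XL.PosSemidef ∧
        (∀ t : ℝ, 0 ≤ t → IsUnit (formulaCore (closedLoop A B Xinf) XL (Xinf - X₀) t)) ∧
        IsDRESolution A B C X₀ (dreFormula (closedLoop A B Xinf) Xinf XL X₀) ∧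
        ∀ X : ℝ → Matrix (Fin n) (Fin n) ℝ, IsDRESolution A B C X₀ X →
          ∀ t : ℝ, 0 ≤ t → X t = dreFormula (closedLoop A B Xinf) Xinf XL X₀ t := by
  obtain ⟨X, hX⟩ := exists_isStabilizingARESolution hAB hAC
  refine ⟨⟨X, hX, fun Z hZ => hZ.eq hX⟩, fun Xinf hXinf => ⟨hXinf.posSemidef,
    hXinf.2.existsUnique_isLyapunovSolution, fun XL hXL =>
      ⟨hXinf.2.posSemidef_of_isLyapunovSolution hXL,
        fun t ht => hXinf.isUnit_formulaCore hX₀ hXL ht,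
        hXinf.isDRESolution_dreFormula hX₀ hXL, fun Z hZ t ht =>
          hZ.eq (hXinf.isDRESolution_dreFormula hX₀ hXL) ht⟩⟩⟩
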